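/- Let $\mathcal{C}$ be a category. A \emph{stable system of monics} $\mathcal{M}$ in $\mathcal{C}$ is a class of monomorphisms that contains all isomorphisms, is closed under composition and is stable under pullback. An \emph{$\mathcal{M}$-partial map classifier} is a functor $T:\mathcal{C}\to\mathcal{C}$ with a natural transformation $\eta:\mathrm{id}_{\mathcal{C}}\to T$ such that every $\eta_X$ is in $\mathcal{M}$ and, for every span $A\xleftarrow{m}X\xrightarrow{f}B$ with $m\in\mathcal{M}$, there is a unique $\varphi:A\to T(B)$ for which $\varphi m=\eta_B f$ is a pullback square. An \emph{$\mathcal{M}$-materialization} of $f:A\to B$ is a factorization $A\xrightarrow{f'}\langle f\rangle\xrightarrow{f''}B$ of $f$ with $f'\in\mathcal{M}$ such that for every factorization $A\xrightarrow{m}D\xrightarrow{\alpha}B$ of $f$ with $m\in\mathcal{M}$ there is a unique $\beta:D\to\langle f\rangle$ with $f''\beta=\alpha$ for which the square $\beta m=f'\,\mathrm{id}_A$ is a pullback. (1) Let $\mathcal{M}$ be a stable system of monics in $\mathcal{C}$, and for each object $X$ let $\mathcal{M}_X$ be a stable system of monics in the slice category $\mathcal{C}/X$. Suppose that every $\mathcal{C}/X$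 has an $\mathcal{M}_X$-partial map classifier, and that each forgetful functor $U_X:\mathcal{C}/X\to\mathcal{C}$ preserves and reflects these classes (that is, $g\in\mathcal{M}_X$ if and only if $U_Xg\in\mathcal{M}$). Then every morphism of $\mathcal{C}$ has an $\mathcal{M}$-materialization. (2) Let $\mathcal{C}$ be a quasitopos, i.e. a category that has all finite limits and finite colimits, is locally cartesian closed, and has a regular-subobject classifier (a morphism $t:1\to\Omega$ such that every regular monomorphism $U\to X$ is the pullback of $t$ along a unique morphism $X\to\Omega$). Then the regular monomorphisms form a stable system of monics in $\mathcal{C}$, and every morphism of $\mathcal{C}$ has an $\mathcal{M}$-materialization for $\mathcal{M}$ the class of regular monomorphisms. -/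

import Mathlib

open CategoryTheory CategoryTheory.Limits

universe v u

/-- A stable system of monics: a class of monomorphisms that contains all isomorphisms and is
closed under composition and stable under pullback. -/
structure IsStableSystemOfMonics {C : Type u} [Category.{v} C] (M : MorphismProperty C) :
    Prop where
  mono : ∀ ⦃A B : C⦄ (m : A ⟶ B), M m → Mono m
  of_isIso : ∀ ⦃A B : C⦄ (m : A ⟶ B), IsIso m → M m
  comp : ∀ ⦃A B D : C⦄ (m : A ⟶ B) (n : B ⟶ D), M m → M n → M (m ≫ n)
  of_isPullback : ∀ ⦃A B D E : C⦄ (m' : A ⟶ D) (f' : A ⟶ B) (f : D ⟶ E) (m : B ⟶ E),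
    IsPullback m' f' f m → M m → M m'

/-- An `M`-partial map classifier `(T, η)`: every span `A ⟵ X ⟶ B` with left leg `m` in `M`
is the pullback of `η_B` along a unique morphism `A ⟶ T B`. -/
structure PartialMapClassifier {C : Type u} [Category.{v} C] (M : MorphismProperty C) where
  T : C ⥤ C
  η : 𝟭 C ⟶ T
  η_mem : ∀ X : C, M (η.app X)
  existsUnique : ∀ ⦃A X B : C⦄ (m : X ⟶ A) (f : X ⟶ B), M m →
    ∃! φ : A ⟶ T.obj B, IsPullback m f φ (η.app B)

/-- An `M`-materialization of `f : A ⟶ B`: a terminal factorization of `f` into a morphism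
of `M` followed by an arbitrary morphism. The comparison `β` from another such factorization
`A ⟶ D ⟶ B` is the unique morphism that commutes with the second legs and makes
```
  A ---m---> D
  |          |
  𝟙          β
  v          v
  A --fst--> obj
```
a pullback square. -/
structure Materialization {C : Type u} [Category.{v} C] (M : MorphismProperty C)
    {A B : C} (f : A ⟶ B) where
  obj : C
  fst : A ⟶ obj
  snd : obj ⟶ B
  fst_mem : M fst
  fac : fst ≫ snd = f
  existsUnique : ∀ ⦃D : C⦄ (m : A ⟶ D) (α : D ⟶ B), M m → m ≫ α = f →
    ∃! β : D ⟶ obj, IsPullback m (𝟙 A) β fst ∧ β ≫ snd = α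

/-- A regular-subobject classifier: a morphism `true : 1 ⟶ Ω` out of a terminal object such that
every regular monomorphism is the pullback of `true` along a unique morphism. -/
structure RegularSubobjectClassifier (C : Type u) [Category.{v} C] where
  one : C
  isTerminal : IsTerminal one
  Ω : C
  truth : one ⟶ Ω
  existsUnique : ∀ ⦃U X : C⦄ (m : U ⟶ X), IsRegularMono m →
    ∃! χ : X ⟶ Ω, IsPullback m (isTerminal.from U) χ truth

/-- Local cartesian closure: every pullback functor `C/Y ⥤ C/X` has a right adjoint. -/
def IsLocallyCartesianClosed (C : Type u) [Category.{v} C] [HasPullbacks C] : Prop :=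
  ∀ ⦃X Y : C⦄ (f : X ⟶ Y), (Over.pullback f).IsLeftAdjoint

/-- A quasitopos: finite limits and colimits, local cartesian closure, and a regular-subobject
classifier. -/
structure IsQuasitopos (C : Type u) [Category.{v} C] : Prop where
  hasFiniteLimits : HasFiniteLimits C
  hasFiniteColimits : HasFiniteColimits C
  locallyCartesianClosed : IsLocallyCartesianClosed C
  regularSubobjectClassifier : Nonempty (RegularSubobjectClassifier C)

/-! (1) A factorization of `f : A ⟶ B` through `m` in `M` is a morphism `m` of `C/B` out of `f`,
hence a partial map from `α` to `f` with total leg `𝟙 A`. The classifier at `f` in `C/B` is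
therefore the materialization; this transfers to `C` because the forgetful functor preserves and
reflects pullbacks.

(2) Let `s = (𝟙, true) : B ⟶ B ⨯ Ω`. A morphism `(α, χ) : D ⟶ B ⨯ Ω` pulls `s` back to the regular
subobject classified by `χ`, so morphisms from `D` to the dependent product of `f` along `s` are
morphisms `α : D ⟶ B` with a partial map into `A` over `B` defined on a regular subobject. Since `s`
is monic, that product restricts along `s` to `f`, which supplies `η`. No closure under composition
is used here; it follows by extending the characteristic map of the first factor along the second.
-/

/-! ### Pullbacks in slices and classifiers over the codomain -/

/-- A commutative square in `Over X` is a pullback as soon as its image in the base category is. -/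
lemma CategoryTheory.Over.isPullback_of_isPullback_left {C : Type u} [Category.{v} C] {X : C} {P Q R S : Over X}
    {a : P ⟶ Q} {b : P ⟶ R} {c : Q ⟶ S} {d : R ⟶ S}
    (h : IsPullback a.left b.left c.left d.left) : IsPullback a b c d := by
  have w : a ≫ c = b ≫ d := by
    ext
    simpa using h.w
  refine ⟨⟨w⟩, ⟨PullbackCone.IsLimit.mk w
    (fun s => Over.homMk (h.lift s.fst.left s.snd.left
      (by simpa using congrArg CommaMorphism.left s.condition)) ?_) ?_ ?_ ?_⟩⟩
  · rw [← Over.w a, h.lift_fst_assoc, Over.w]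
  · intro s
    ext
    simp
  · intro s
    ext
    simp
  · intro s m h₁ h₂
    ext
    apply h.hom_ext
    · simpa using congrArg CommaMorphism.left h₁
    · simpa using congrArg CommaMorphism.left h₂

/-- The forgetful functor from `Over X` preserves pullback squares. -/
lemma CategoryTheory.Over.isPullback_left {C : Type u} [Category.{v} C] {X : C} {P Q R S : Over X}
    {a : P ⟶ Q} {b : P ⟶ R} {c : Q ⟶ S} {d : R ⟶ S}
    (h : IsPullback a b c d) : IsPullback a.left b.left c.left d.left := by
  have w : a.left ≫ c.left = b.left ≫ d.left := by
    simpa using congrArg CommaMorphism.left h.w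
  -- Either leg of a cone in `C` makes its apex an object over `X`, so the cone lifts to the slice.
  have key : ∀ {W : C} (x : W ⟶ Q.left) (y : W ⟶ R.left), x ≫ c.left = y ≫ d.left →
      ∃ l : W ⟶ P.left, l ≫ a.left = x ∧ l ≫ b.left = y := by
    intro W x y hxy
    have hy : y ≫ R.hom = x ≫ Q.hom := by
      rw [← Over.w d, ← reassoc_of% hxy, Over.w]
    let x' : Over.mk (x ≫ Q.hom) ⟶ Q := Over.homMk x
    let y' : Over.mk (x ≫ Q.hom) ⟶ R := Over.homMk y hy
    have hxy' : x' ≫ c = y' ≫ d := by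
      ext
      exact hxy
    exact ⟨(h.lift x' y' hxy').left, congrArg CommaMorphism.left (h.lift_fst x' y' hxy'),
      congrArg CommaMorphism.left (h.lift_snd x' y' hxy')⟩
  have uniq : ∀ {W : C} (l l' : W ⟶ P.left), l ≫ a.left = l' ≫ a.left →
      l ≫ b.left = l' ≫ b.left → l = l' := by
    intro W l l' h₁ h₂
    have hl : l' ≫ P.hom = l ≫ P.hom := by
      rw [← Over.w a, ← reassoc_of% h₁]
    let k : Over.mk (l ≫ P.hom) ⟶ P := Over.homMk l
    let k' : Over.mk (l ≫ P.hom) ⟶ P := Over.homMk l' hl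
    have : k = k' := by
      apply h.hom_ext
      · ext
        exact h₁
      · ext
        exact h₂
    exact congrArg CommaMorphism.left this
  refine ⟨⟨w⟩, ⟨PullbackCone.IsLimit.mk w
    (fun s => (key s.fst s.snd s.condition).choose)
    (fun s => (key s.fst s.snd s.condition).choose_spec.1)
    (fun s => (key s.fst s.snd s.condition).choose_spec.2) ?_⟩⟩
  intro s m h₁ h₂
  apply uniq
  · rw [h₁, (key s.fst s.snd s.condition).choose_spec.1]
  · rw [h₂, (key s.fst s.snd s.condition).choose_spec.2]

/-- A partial map classifier in the slice over `B` provides a materialization of every morphism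
into `B`. -/
lemma PartialMapClassifier.nonempty_materialization {C : Type u} [Category.{v} C]
    {M : MorphismProperty C} {A B : C} {MB : MorphismProperty (Over B)}
    (hM : ∀ ⦃P Q : Over B⦄ (g : P ⟶ Q), MB g ↔ M g.left)
    (T : PartialMapClassifier MB) (f : A ⟶ B) : Nonempty (Materialization M f) := by
  refine ⟨⟨(T.T.obj (Over.mk f)).left, (T.η.app (Over.mk f)).left, (T.T.obj (Over.mk f)).hom,
    (hM _).1 (T.η_mem _), Over.w (T.η.app (Over.mk f)), ?_⟩⟩
  intro D m α hm hα
  let m' : Over.mk f ⟶ Over.mk α := Over.homMk m hα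
  obtain ⟨φ, hφ, hφ'⟩ := T.existsUnique m' (𝟙 (Over.mk f)) ((hM _).2 hm)
  refine ⟨φ.left, ⟨Over.isPullback_left hφ, Over.w φ⟩, ?_⟩
  rintro β ⟨hβ, hβα⟩
  let β' : Over.mk α ⟶ T.T.obj (Over.mk f) := Over.homMk β hβα
  have : β' = φ := hφ' β' (Over.isPullback_of_isPullback_left hβ)
  exact congrArg CommaMorphism.left this

/-! ### Dependent products along a monomorphism -/

/-- The dependent product of `f : A ⟶ B` along `s : B ⟶ Y`, as an object `q : E ⟶ Y` with an
evaluation morphism on the pullback of `q` along `s`. -/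
lemma exists_dependentProduct {C : Type u} [Category.{v} C] [HasPullbacks C] {A B Y : C}
    (s : B ⟶ Y) (hs : (Over.pullback s).IsLeftAdjoint) (f : A ⟶ B) :
    ∃ (E : C) (q : E ⟶ Y) (ε : pullback q s ⟶ A), ε ≫ f = pullback.snd q s ∧
      ∀ ⦃D X : C⦄ (a : X ⟶ D) (b : X ⟶ B) (χ : D ⟶ Y) (k : X ⟶ A), IsPullback a b χ s →
        k ≫ f = b → ∃! β : D ⟶ E, β ≫ q = χ ∧ ∀ l : X ⟶ pullback q s,
          l ≫ pullback.fst q s = a ≫ β → l ≫ pullback.snd q s = b → l ≫ ε = k := by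
  let adj := Adjunction.ofIsLeftAdjoint (Over.pullback s)
  let E := (Over.pullback s).rightAdjoint.obj (Over.mk f)
  let ε := adj.counit.app (Over.mk f)
  refine ⟨E.left, E.hom, ε.left, Over.w ε, ?_⟩
  intro D X a b χ k h hk
  have hiso : h.isoPullback.inv ≫ k ≫ f = pullback.snd χ s := by
    rw [hk, h.isoPullback_inv_snd]
  let k' : (Over.pullback s).obj (Over.mk χ) ⟶ Over.mk f :=
    Over.homMk (h.isoPullback.inv ≫ k) (by simpa using hiso)
  -- Evaluation along `γ` computes its transpose, read on `X` in place of the chosen pullback of `χ`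
  -- and `s`.
  have hev : ∀ (γ : Over.mk χ ⟶ E) (l : X ⟶ pullback E.hom s),
      l ≫ pullback.fst E.hom s = a ≫ γ.left → l ≫ pullback.snd E.hom s = b →
      l ≫ ε.left = h.isoPullback.hom ≫ ((adj.homEquiv _ _).symm γ).left := by
    intro γ l h₁ h₂
    have hl : l = h.isoPullback.hom ≫ ((Over.pullback s).map γ).left := by
      apply pullback.hom_ext
      · have : ((Over.pullback s).map γ).left ≫ pullback.fst E.hom s =
            pullback.fst χ s ≫ γ.left := pullback.lift_fst _ _ _
        rw [h₁, Category.assoc, this, h.isoPullback_hom_fst_assoc]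
      · have : ((Over.pullback s).map γ).left ≫ pullback.snd E.hom s = pullback.snd χ s :=
          pullback.lift_snd _ _ _
        rw [h₂, Category.assoc, this, h.isoPullback_hom_snd]
    rw [adj.homEquiv_counit, hl, Category.assoc, Over.comp_left]
  refine ⟨((adj.homEquiv _ _) k').left, ⟨Over.w ((adj.homEquiv _ _) k'), ?_⟩, ?_⟩
  · intro l h₁ h₂
    rw [hev _ l h₁ h₂]
    simp [k']
  · rintro β ⟨hβ, hβk⟩
    let β' : Over.mk χ ⟶ E := Over.homMk β hβ
    have hw : (a ≫ β) ≫ E.hom = b ≫ s := by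
      rw [Category.assoc, hβ, h.w]
    have h₁ := hβk (pullback.lift (a ≫ β) b hw) (pullback.lift_fst _ _ _)
      (pullback.lift_snd _ _ _)
    replace h₁ := (hev β' (pullback.lift (a ≫ β) b hw) (pullback.lift_fst _ _ _)
      (pullback.lift_snd _ _ _)).symm.trans h₁
    have h₂ : (adj.homEquiv _ _).symm β' = k' := by
      ext
      simp [k', ← h₁]
    have : β' = adj.homEquiv _ _ k' := by
      rw [← h₂, Equiv.apply_symm_apply]
    exact congrArg CommaMorphism.left this

/-- The dependent product of `f` along a monomorphism `s` pulls back along `s` to `f`, and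
represents morphisms into `f` defined on a pullback of `s`. -/
lemma exists_dependentProduct_of_mono {C : Type u} [Category.{v} C] [HasPullbacks C] {A B Y : C}
    (s : B ⟶ Y) [Mono s] (hs : (Over.pullback s).IsLeftAdjoint) (f : A ⟶ B) :
    ∃ (E : C) (q : E ⟶ Y) (η : A ⟶ E), IsPullback η f q s ∧
      ∀ ⦃D X : C⦄ (a : X ⟶ D) (b : X ⟶ B) (χ : D ⟶ Y) (k : X ⟶ A), IsPullback a b χ s →
        k ≫ f = b → ∃! β : D ⟶ E, β ≫ q = χ ∧ a ≫ β = k ≫ η := by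
  obtain ⟨E, q, ε, hε, H⟩ := exists_dependentProduct s hs f
  -- As `s` is monic, pulling it back along a map that factors through it gives the whole domain.
  have hself : ∀ {D : C} (b : D ⟶ B), IsPullback (𝟙 D) b (b ≫ s) s := by
    intro D b
    have h : IsPullback (𝟙 D) b b (𝟙 B) := IsPullback.of_horiz_isIso ⟨by simp⟩
    simpa using (h.flip.paste_horiz (IsKernelPair.id_of_mono s)).flip
  obtain ⟨η, ⟨hη, hηε⟩, -⟩ := H (𝟙 A) f (f ≫ s) (𝟙 A) (hself f) (Category.id_comp f)
  let u : A ⟶ pullback q s := pullback.lift η f hη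
  have hu₁ : u ≫ pullback.fst q s = η := pullback.lift_fst _ _ _
  have hu₂ : u ≫ pullback.snd q s = f := pullback.lift_snd _ _ _
  have hu : u ≫ ε = 𝟙 A := hηε u (by rw [hu₁, Category.id_comp]) hu₂
  -- Both sides are morphisms over `Y` with the same transpose `ε`. Hence `u` and `ε` are mutually
  -- inverse.
  have hεη : ε ≫ η = pullback.fst q s := by
    refine (H (𝟙 _) (pullback.snd q s) (pullback.snd q s ≫ s) ε (hself _) hε).unique
      ⟨?_, ?_⟩ ⟨pullback.condition, ?_⟩
    · rw [Category.assoc, hη, reassoc_of% hε]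
    · intro l h₁ h₂
      have : l = ε ≫ u := by
        apply pullback.hom_ext
        · rw [h₁, Category.id_comp, Category.assoc, hu₁]
        · rw [h₂, Category.assoc, hu₂, hε]
      rw [this, Category.assoc, hu, Category.comp_id]
    · intro l h₁ h₂
      have : l = 𝟙 _ := by
        apply pullback.hom_ext
        · simpa using h₁
        · simpa using h₂
      rw [this, Category.id_comp]
  have huε : ε ≫ u = 𝟙 _ := by
    apply pullback.hom_ext
    · rw [Category.assoc, hu₁, hεη, Category.id_comp]
    · rw [Category.assoc, hu₂, hε, Category.id_comp]
  refine ⟨E, q, η, ?_, ?_⟩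
  · exact IsPullback.of_iso_pullback ⟨hη⟩ ⟨u, ε, hu, huε⟩ hu₁ hu₂
  · intro D X a b χ k h hk
    have key : ∀ β : D ⟶ E, β ≫ q = χ → ((∀ l : X ⟶ pullback q s,
        l ≫ pullback.fst q s = a ≫ β → l ≫ pullback.snd q s = b → l ≫ ε = k) ↔
          a ≫ β = k ≫ η) := by
      intro β hβ
      constructor
      · intro hl
        have hw : (a ≫ β) ≫ q = b ≫ s := by
          rw [Category.assoc, hβ, h.w]
        rw [← hl (pullback.lift (a ≫ β) b hw) (pullback.lift_fst _ _ _)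
          (pullback.lift_snd _ _ _), Category.assoc, hεη,
          pullback.lift_fst]
      · intro hβk l h₁ h₂
        have : l = k ≫ u := by
          apply pullback.hom_ext
          · rw [h₁, hβk, Category.assoc, hu₁]
          · rw [h₂, Category.assoc, hu₂, hk]
        rw [this, Category.assoc, hu, Category.comp_id]
    obtain ⟨β, ⟨hβ, hβk⟩, huniq⟩ := H a b χ k h hk
    exact ⟨β, ⟨hβ, (key β hβ).1 hβk⟩, fun γ hγ => huniq γ ⟨hγ.1, (key γ hγ.1).2 hγ.2⟩⟩

/-! ### Regular monomorphisms in a quasitopos -/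

/-- A pullback of a regular monomorphism is a regular monomorphism. -/
lemma CategoryTheory.IsPullback.isRegularMono {C : Type u} [Category.{v} C] {A B D E : C} {m' : A ⟶ D}
    {f' : A ⟶ B} {f : D ⟶ E} {m : B ⟶ E} (h : IsPullback m' f' f m) (hm : IsRegularMono m) :
    IsRegularMono m' :=
  ⟨⟨regularOfIsPullbackFstOfRegular hm.getStruct h.w h.isLimit⟩⟩

/-- In a quasitopos, every morphism `f : A ⟶ B` has a classifier of the partial morphisms over
`B` into `f` that are defined on regular subobjects. -/
lemma IsQuasitopos.exists_partialMapClassifier {C : Type u} [Category.{v} C]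
    (hC : IsQuasitopos C) {A B : C} (f : A ⟶ B) :
    ∃ (E : C) (η : A ⟶ E) (p : E ⟶ B), IsRegularMono η ∧ η ≫ p = f ∧
      ∀ ⦃D X : C⦄ (m : X ⟶ D) (g : X ⟶ A) (α : D ⟶ B), IsRegularMono m → m ≫ α = g ≫ f →
        ∃! β : D ⟶ E, IsPullback m g β η ∧ β ≫ p = α := by
  have := hC.hasFiniteLimits
  obtain ⟨c⟩ := hC.regularSubobjectClassifier
  let s : B ⟶ B ⨯ c.Ω := prod.lift (𝟙 B) (c.isTerminal.from B ≫ c.truth)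
  have hs₁ : s ≫ prod.fst = 𝟙 B := prod.lift_fst _ _
  have hs₂ : s ≫ prod.snd = c.isTerminal.from B ≫ c.truth := prod.lift_snd _ _
  have : IsSplitMono s := ⟨⟨⟨prod.fst, hs₁⟩⟩⟩
  -- The map `s` is itself the pullback of `truth` along `prod.snd`, so only the second component of
  -- `χ` matters.
  have hpull : ∀ {D X : C} (m : X ⟶ D) (χ : D ⟶ B ⨯ c.Ω) (b : X ⟶ B), m ≫ χ ≫ prod.fst = b →
      (IsPullback m b χ s ↔ IsPullback m (c.isTerminal.from X) (χ ≫ prod.snd) c.truth) := by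
    intro D X m χ b hb
    constructor
    · intro h
      refine ⟨⟨?_⟩, ⟨PullbackCone.IsLimit.mk _ (fun t => h.lift t.fst (t.fst ≫ χ ≫ prod.fst) ?_)
        ?_ ?_ ?_⟩⟩
      · rw [← Category.assoc, h.w, Category.assoc, hs₂, ← Category.assoc]
        congr 1
        exact c.isTerminal.hom_ext _ _
      · have := t.condition
        apply Limits.prod.hom_ext
        · simp [hs₁]
        · simp only [Category.assoc, hs₂, this]
          simp only [← Category.assoc]
          congr 1
          exact c.isTerminal.hom_ext _ _
      · intro t
        exact h.lift_fst _ _ _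
      · intro t
        exact c.isTerminal.hom_ext _ _
      · intro t l h₁ h₂
        apply h.hom_ext
        · rw [h₁, h.lift_fst]
        · rw [h.lift_snd, ← h₁, ← hb, Category.assoc]
    · intro h
      have hw : m ≫ χ = b ≫ s := by
        apply Limits.prod.hom_ext
        · simp [hs₁, hb]
        · simp only [Category.assoc, hs₂, h.w]
          simp only [← Category.assoc]
          congr 1
          exact c.isTerminal.hom_ext _ _
      refine ⟨⟨hw⟩, ⟨PullbackCone.IsLimit.mk _
        (fun t => h.lift t.fst (c.isTerminal.from _) ?_) ?_ ?_ ?_⟩⟩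
      · rw [← Category.assoc, t.condition, Category.assoc, hs₂, ← Category.assoc]
        congr 1
        exact c.isTerminal.hom_ext _ _
      · intro t
        exact h.lift_fst _ _ _
      · intro t
        rw [← cancel_mono s, Category.assoc, ← hw, h.lift_fst_assoc, t.condition]
      · intro t l h₁ h₂
        apply h.hom_ext
        · rw [h₁, h.lift_fst]
        · exact c.isTerminal.hom_ext _ _
  obtain ⟨E, q, η, hη, H⟩ :=
    exists_dependentProduct_of_mono s (hC.locallyCartesianClosed s) f
  have hηf : η ≫ q ≫ prod.fst = f := by
    rw [← Category.assoc, hη.w, Category.assoc, hs₁, Category.comp_id]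
  refine ⟨E, η, q ≫ prod.fst, hη.isRegularMono inferInstance, hηf, ?_⟩
  intro D X m g α hm hα
  obtain ⟨χ, hχ, hχ'⟩ := c.existsUnique m hm
  have hχα : IsPullback m (g ≫ f) (prod.lift α χ) s :=
    (hpull m (prod.lift α χ) (g ≫ f) (by rw [prod.lift_fst, hα])).2 (by rwa [prod.lift_snd])
  obtain ⟨β, ⟨hβ, hβg⟩, huniq⟩ := H m (g ≫ f) (prod.lift α χ) g hχα rfl
  refine ⟨β, ⟨IsPullback.of_bot (by rwa [hβ]) hβg hη, by rw [reassoc_of% hβ, prod.lift_fst]⟩, ?_⟩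
  rintro γ ⟨hγ, hγα⟩
  refine huniq γ ⟨?_, hγ.w⟩
  -- Pasting with `hη` shows that the `Ω`-component of `γ ≫ q` classifies `m`, so it must be `χ`.
  have h₁ := (hpull m (γ ≫ q) (g ≫ f) (by simp only [Category.assoc, hγα, hα])).1
    (hγ.paste_vert hη)
  apply Limits.prod.hom_ext
  · rw [prod.lift_fst, Category.assoc, hγα]
  · rw [prod.lift_snd, hχ' _ h₁]

/-- In a quasitopos, regular monomorphisms are closed under composition. -/
lemma IsQuasitopos.isRegularMono_comp {C : Type u} [Category.{v} C] (hC : IsQuasitopos C)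
    {A B D : C} (m : A ⟶ B) (n : B ⟶ D) (hm : IsRegularMono m) (hn : IsRegularMono n) :
    IsRegularMono (m ≫ n) := by
  obtain ⟨c⟩ := hC.regularSubobjectClassifier
  obtain ⟨χ, hχ, -⟩ := c.existsUnique m hm
  -- Over the terminal object this classifies partial maps into `Ω`; `φ` extends `χ` along `n`.
  obtain ⟨E, η, p, -, -, H⟩ := hC.exists_partialMapClassifier (c.isTerminal.from c.Ω)
  obtain ⟨φ, ⟨hφ, -⟩, -⟩ := H n χ (c.isTerminal.from D) hn (c.isTerminal.hom_ext _ _)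
  -- A map out of a terminal object splits, and `m ≫ n` is the pullback of this one along `φ`.
  have : IsSplitMono (c.truth ≫ η) := ⟨⟨⟨c.isTerminal.from E, c.isTerminal.hom_ext _ _⟩⟩⟩
  exact (hχ.flip.paste_vert hφ.flip).flip.isRegularMono inferInstance

theorem mainTheorem8 {C : Type u} [Category.{v} C] :
    (∀ (M : MorphismProperty C) (MX : ∀ X : C, MorphismProperty (Over X)),
      IsStableSystemOfMonics M →
      (∀ X : C, Nonempty (PartialMapClassifier (MX X))) →
      (∀ (X : C) ⦃A B : Over X⦄ (g : A ⟶ B), MX X g → M ((Over.forget X).map g)) →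
      (∀ (X : C) ⦃A B : Over X⦄ (g : A ⟶ B), M ((Over.forget X).map g) → MX X g) →
      ∀ ⦃A B : C⦄ (f : A ⟶ B), Nonempty (Materialization M f)) ∧
    (IsQuasitopos C →
      IsStableSystemOfMonics (MorphismProperty.regularMono C) ∧
      ∀ ⦃A B : C⦄ (f : A ⟶ B),
        Nonempty (Materialization (MorphismProperty.regularMono C) f)) := by
  refine ⟨?_, fun hC => ⟨⟨?_, ?_, ?_, ?_⟩, ?_⟩⟩
  · intro M MX _ hT h₁ h₂ A B f
    obtain ⟨T⟩ := hT B
    exact T.nonempty_materialization (fun P Q g => ⟨h₁ B g, h₂ B g⟩) f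
  · intro A B m hm
    exact hm.regularMono.some.mono
  · intro A B m hm
    exact ⟨⟨RegularMono.ofIso (asIso m)⟩⟩
  · intro A B D m n hm hn
    exact hC.isRegularMono_comp m n hm hn
  · intro A B D E m' f' f m h hm
    exact h.isRegularMono hm
  · intro A B f
    obtain ⟨E, η, p, hη, hfac, H⟩ := hC.exists_partialMapClassifier f
    exact ⟨⟨E, η, p, hη, hfac, fun D m α hm hα => H m (𝟙 A) α hm (by simpa using hα)⟩⟩
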